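/- Let $\Sigma$ be a connected real-analytic manifold (finite-dimensional, Hausdorff, second countable) and let $G$ be a compact connected Lie group with more than one element, with normalized Haar measure $dg$. A \emph{piecewise analytic path} in $\Sigma$ is a map $p:[0,1]\to\Sigma$ which is a finite concatenation of constant pieces and embedded analytic arcs (real analytic on a closed interval, injective, with nowhere vanishing velocity). Let $\bar{\mathcal A}$ be the space of all generalized (quantum) connections, i.e. of all maps $\bar A$, with no continuity requirement, that assign to every piecewise analytic path $p$ an element $\bar A(p)\in G$ in such a way that $\bar A(p)$ is unchanged under orientation-preserving reparametrization of $p$, $\bar A(q\circ p)=\bar A(q)\bar A(p)$ whenever $q$ starts where $p$ ends ($q\circ p$ denoting $p$ followed by $q$), and $\bar A(p^{-1})=\bar A(p)^{-1}$ for the reversed path $p^{-1}$. Give $\bar{\mathcal A}$ the topology of pointwise convergence and its Borel $\sigma$-algebra. The Ashtekar--Lewandowski measure $\mu_{AL}$ is the regular Borel probability measure on $\bar{\mathcal A}$ such that $$\int_{\bar{\mathcal A}} F(\bar A(e_1),\dots,\bar A(e_k))\,d\mu_{AL}(\bar A)=\int_{G^k}F(g_1,\dots,g_k)\,dg_1\cdots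 dg_k$$ for all embedded analytic arcs $e_1,\dots,e_k$, different ones of which meet at most in their end points, and all bounded Borel functions $F:G^k\to\mathbb C$. Let $e:[0,1]\to\Sigma$ be any edge, that is, any finite concatenation of embedded analytic arcs, and for $s\in[0,1]$ let $e_s(t)=e(st)$, $t\in[0,1]$, be its initial segment. For $\bar A\in\bar{\mathcal A}$ put $v_{\bar A}:[0,1]\to G$, $v_{\bar A}(s)=\bar A(e_s)$. Then $\mu_{AL}$ is supported on the set $$W=\{\bar A\in\bar{\mathcal A} : v_{\bar A} \text{ is discontinuous at every point of } [0,1]\},$$ i.e. the complement of $W$ is contained in a set of $\mu_{AL}$-measure zero. -/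

import Mathlib

open MeasureTheory Set
open scoped Manifold ContDiff unitInterval

namespace AL

section Curves

variable {n : ℕ} {M : Type*} [TopologicalSpace M] [ChartedSpace (EuclideanSpace ℝ (Fin n)) M]

/-- `c` restricted to the nondegenerate compact interval `[a, b]` is an embedded analytic arc:
real analytic up to and including the end points, injective, with nowhere vanishing velocity. -/
structure IsAnalyticArcOn (n : ℕ) {M : Type*} [TopologicalSpace M]
    [ChartedSpace (EuclideanSpace ℝ (Fin n)) M] (c : ℝ → M) (a b : ℝ) : Prop where
  lt : a < b
  analytic : ContMDiffOn 𝓘(ℝ, ℝ) (𝓡 n) ω c (Icc a b)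
  injOn : InjOn c (Icc a b)
  immersed : ∀ t ∈ Icc a b, mfderivWithin 𝓘(ℝ, ℝ) (𝓡 n) c (Icc a b) t ≠ 0

/-- `c` on `[a, b]` is a finite concatenation of embedded analytic arcs. -/
inductive IsPiecewiseArcOn (n : ℕ) {M : Type*} [TopologicalSpace M]
    [ChartedSpace (EuclideanSpace ℝ (Fin n)) M] (c : ℝ → M) : ℝ → ℝ → Prop
  | arc {a b : ℝ} : IsAnalyticArcOn n c a b → IsPiecewiseArcOn n c a b
  | concat {a b d : ℝ} :
      IsPiecewiseArcOn n c a b → IsPiecewiseArcOn n c b d → IsPiecewiseArcOn n c a d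

/-- `c` on `[a, b]` is a finite concatenation of embedded analytic arcs and of constant pieces. -/
inductive IsPiecewiseAnalyticOn (n : ℕ) {M : Type*} [TopologicalSpace M]
    [ChartedSpace (EuclideanSpace ℝ (Fin n)) M] (c : ℝ → M) : ℝ → ℝ → Prop
  | arc {a b : ℝ} : IsAnalyticArcOn n c a b → IsPiecewiseAnalyticOn n c a b
  | const {a b : ℝ} : a ≤ b → (∀ t ∈ Icc a b, c t = c a) → IsPiecewiseAnalyticOn n c a b
  | concat {a b d : ℝ} :
      IsPiecewiseAnalyticOn n c a b → IsPiecewiseAnalyticOn n c b d → IsPiecewiseAnalyticOn n c a d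

theorem IsAnalyticArcOn.comp_affine {c c' : ℝ → M} {a b a' b' k m : ℝ}
    (h : IsAnalyticArcOn n c a b) (hab : a' < b') (hk : k ≠ 0)
    (hm : ∀ t ∈ Icc a' b', k * t + m ∈ Icc a b)
    (hc : ∀ t ∈ Icc a' b', c' t = c (k * t + m)) : IsAnalyticArcOn n c' a' b' := by
  have hsm : ContMDiff 𝓘(ℝ, ℝ) 𝓘(ℝ, ℝ) ω (fun t : ℝ => k * t + m) :=
    ContDiff.contMDiff (by fun_prop)
  refine ⟨hab, ?_, ?_, ?_⟩
  · exact (h.analytic.comp hsm.contMDiffOn hm).congr hc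
  · intro x hx y hy hxy
    rw [hc x hx, hc y hy] at hxy
    have := h.injOn (hm x hx) (hm y hy) hxy
    exact mul_left_cancel₀ hk (add_right_cancel this)
  · intro t ht
    have hu : UniqueMDiffWithinAt 𝓘(ℝ, ℝ) (Icc a' b') t :=
      (uniqueDiffOn_Icc hab t ht).uniqueMDiffWithinAt
    have hd : MDifferentiableWithinAt 𝓘(ℝ, ℝ) (𝓡 n) c (Icc a b) (k * t + m) :=
      (h.analytic _ (hm t ht)).mdifferentiableWithinAt (by simp)
    have ha : HasDerivAt (fun t : ℝ => k * t + m) k t := by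
      simpa using ((hasDerivAt_id t).const_mul k).add_const m
    have ha' := ha.hasFDerivAt.hasMFDerivAt.hasMFDerivWithinAt (s := Icc a' b')
    have h0 := (HasMFDerivWithinAt.comp (f := fun t : ℝ => k * t + m) t hd.hasMFDerivWithinAt ha'
      (fun x hx => hm x hx)).congr_of_eventuallyEq
      (f₁ := c') (Filter.eventually_of_mem self_mem_nhdsWithin hc) (hc t ht)
    rw [h0.mfderivWithin hu]
    have key : ∀ L : ℝ →L[ℝ] EuclideanSpace ℝ (Fin n),
        L.comp (ContinuousLinearMap.toSpanSingleton ℝ k) = 0 → L = 0 := by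
      intro L hL
      ext1
      have h2 := congrArg (fun L : ℝ →L[ℝ] EuclideanSpace ℝ (Fin n) => L k⁻¹) hL
      simpa [hk] using h2
    exact fun h1 => h.immersed _ (hm t ht) (key _ h1)

theorem IsPiecewiseAnalyticOn.le {c : ℝ → M} {a b : ℝ} (h : IsPiecewiseAnalyticOn n c a b) :
    a ≤ b := by
  induction h with
  | arc h => exact h.lt.le
  | const h _ => exact h
  | concat _ _ h1 h2 => exact h1.trans h2

theorem IsPiecewiseAnalyticOn.comp_affine {c c' : ℝ → M} {a b : ℝ}
    (h : IsPiecewiseAnalyticOn n c a b) {k m : ℝ} : ∀ {a' b' : ℝ}, a' ≤ b' →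
    (∀ t ∈ Icc a' b', k * t + m ∈ Icc a b) →
    (∀ t ∈ Icc a' b', c' t = c (k * t + m)) → IsPiecewiseAnalyticOn n c' a' b' := by
  rcases eq_or_ne k 0 with rfl | hk
  · intro a' b' hab _ hc
    exact .const hab fun t ht => by
      rw [hc t ht, hc a' (left_mem_Icc.2 hab)]; simp
  induction h with
  | arc h =>
    intro a' b' hab hm hc
    rcases hab.eq_or_lt with rfl | hlt
    · exact .const le_rfl fun t ht => by rw [le_antisymm ht.2 ht.1]
    · exact .arc (h.comp_affine hlt hk hm hc)
  | @const a b hle h =>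
    intro a' b' hab hm hc
    exact .const hab fun t ht => by
      rw [hc t ht, hc a' (left_mem_Icc.2 hab), h _ (hm t ht), h _ (hm _ (left_mem_Icc.2 hab))]
  | @concat a b d _ _ ih1 ih2 =>
    intro a' b' hab hm hc
    -- `u` is the parameter of the junction
    obtain ⟨u, hu⟩ : ∃ u, k * u + m = b := ⟨(b - m) / k, by field_simp; ring⟩
    have key : ∀ x y, a' ≤ x → x ≤ y → y ≤ b' → (y ≤ u ∨ u ≤ x) →
        IsPiecewiseAnalyticOn n c' x y := by
      intro x y hx hxy hy hxu
      have hsub : ∀ t ∈ Icc x y, t ∈ Icc a' b' := fun t ht => ⟨hx.trans ht.1, ht.2.trans hy⟩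
      have hside : (∀ t ∈ Icc x y, k * t + m ≤ b) ∨ (∀ t ∈ Icc x y, b ≤ k * t + m) := by
        rcases hxu with h | h <;> rcases lt_or_gt_of_ne hk with hk' | hk'
        · right; intro t ht; nlinarith [ht.2]
        · left; intro t ht; nlinarith [ht.2]
        · left; intro t ht; nlinarith [ht.1]
        · right; intro t ht; nlinarith [ht.1]
      rcases hside with h | h
      · exact ih1 hxy (fun t ht => ⟨(hm t (hsub t ht)).1, h t ht⟩) fun t ht => hc t (hsub t ht)
      · exact ih2 hxy (fun t ht => ⟨h t ht, (hm t (hsub t ht)).2⟩) fun t ht => hc t (hsub t ht)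
    by_cases h1 : b' ≤ u
    · exact key a' b' le_rfl hab le_rfl (.inl h1)
    by_cases h2 : u ≤ a'
    · exact key a' b' le_rfl hab le_rfl (.inr h2)
    push Not at h1 h2
    exact .concat (key a' u le_rfl h2.le h1.le (.inl le_rfl))
      (key u b' h2.le h1.le le_rfl (.inr le_rfl))

end Curves

/-- Piecewise analytic paths `[0, 1] → M` (arcs and constant pieces). -/
structure PAPath (n : ℕ) (M : Type*) [TopologicalSpace M]
    [ChartedSpace (EuclideanSpace ℝ (Fin n)) M] where
  toMap : C(I, M)
  piecewise : IsPiecewiseAnalyticOn n (IccExtend zero_le_one toMap) 0 1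

namespace PAPath

variable {n : ℕ} {M : Type*} [TopologicalSpace M] [ChartedSpace (EuclideanSpace ℝ (Fin n)) M]

/-- The initial segment `p_s`, that is `p_s(t) = p(st)`. -/
def upTo (p : PAPath n M) (s : I) : PAPath n M where
  toMap := ⟨fun t => p.toMap (s * t), by fun_prop⟩
  piecewise := by
    refine p.piecewise.comp_affine (k := s) (m := 0) zero_le_one (fun t ht => ?_) (fun t ht => ?_)
    · rw [add_zero]; exact ⟨mul_nonneg s.2.1 ht.1, mul_le_one₀ s.2.2 ht.1 ht.2⟩
    · have h : (s : ℝ) * t + 0 ∈ Icc (0 : ℝ) 1 := by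
        rw [add_zero]; exact ⟨mul_nonneg s.2.1 ht.1, mul_le_one₀ s.2.2 ht.1 ht.2⟩
      rw [IccExtend_of_mem _ _ ht, IccExtend_of_mem _ _ h]
      exact congrArg p.toMap (Subtype.ext (by simp))

/-- The reversed path `t ↦ p(1 - t)`. -/
def reverse (p : PAPath n M) : PAPath n M where
  toMap := ⟨fun t => p.toMap (unitInterval.symm t), by fun_prop⟩
  piecewise := by
    refine p.piecewise.comp_affine (k := -1) (m := 1) zero_le_one (fun t ht => ?_) (fun t ht => ?_)
    · exact ⟨by linarith [ht.2], by linarith [ht.1]⟩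
    · have h : (-1 : ℝ) * t + 1 ∈ Icc (0 : ℝ) 1 := ⟨by linarith [ht.2], by linarith [ht.1]⟩
      rw [IccExtend_of_mem _ _ ht, IccExtend_of_mem _ _ h]
      exact congrArg p.toMap (Subtype.ext (by simp [unitInterval.symm]; ring))

/-- The final segment `t ↦ p(s + (1 - s)t)`. -/
def startingAt (p : PAPath n M) (s : I) : PAPath n M :=
  (p.reverse.upTo (unitInterval.symm s)).reverse

theorem startingAt_apply (p : PAPath n M) (s t u : I) (hu : (u : ℝ) = s + (1 - s) * t) :
    (p.startingAt s).toMap t = p.toMap u :=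
  congrArg p.toMap (Subtype.ext (by simp [hu, unitInterval.symm]; ring))

/-- The path is a single embedded analytic arc. -/
def IsArc (p : PAPath n M) : Prop := IsAnalyticArcOn n (IccExtend zero_le_one p.toMap) 0 1

/-- The path is a finite concatenation of embedded analytic arcs (no constant pieces). -/
def IsPiecewiseArc (p : PAPath n M) : Prop :=
  IsPiecewiseArcOn n (IccExtend zero_le_one p.toMap) 0 1

end PAPath

/-- The space `𝒜̄` of generalized (quantum) connections, realized as parallel transports (a reference
point being chosen in each fiber): all maps from piecewise analytic paths to `G`, with no continuity
requirement, that are independent of the parametrization and compatible with composition and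
reversal of paths. -/
structure GenConnection (n : ℕ) (M : Type*) [TopologicalSpace M]
    [ChartedSpace (EuclideanSpace ℝ (Fin n)) M] (G : Type*) [Group G] where
  hol : PAPath n M → G
  hol_reparam : ∀ (p q : PAPath n M) (φ : I ≃o I), (∀ t, q.toMap t = p.toMap (φ t)) → hol q = hol p
  hol_comp : ∀ (p : PAPath n M) (s : I), hol p = hol (p.startingAt s) * hol (p.upTo s)
  hol_reverse : ∀ p : PAPath n M, hol p.reverse = (hol p)⁻¹

section Measure

variable {n : ℕ} {M : Type*} [TopologicalSpace M] [ChartedSpace (EuclideanSpace ℝ (Fin n)) M]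
  {G : Type*} [Group G] [TopologicalSpace G]

/-- The topology of pointwise convergence, i.e. the one induced by the product of copies of `G`. -/
instance : TopologicalSpace (GenConnection n M G) :=
  TopologicalSpace.induced GenConnection.hol inferInstance

instance : MeasurableSpace (GenConnection n M G) := borel _

instance : BorelSpace (GenConnection n M G) := ⟨rfl⟩

/-- A finite family of embedded analytic arcs, different ones meeting at most in their end points. -/
structure IsGraph {k : ℕ} (e : Fin k → PAPath n M) : Prop where
  isArc : ∀ i, (e i).IsArc
  inter : ∀ i j, i ≠ j → ∀ s t : I, (e i).toMap s = (e j).toMap t →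
    (s = 0 ∨ s = 1) ∧ (t = 0 ∨ t = 1)

/-- `μ` is the Ashtekar–Lewandowski measure on `𝒜̄`: the regular Borel probability measure for which
the parallel transports along the edges of every finite graph are distributed according to the
product of the normalized Haar measures, i.e.
`∫ F(Ā(e₁), …, Ā(eₖ)) dμ(Ā) = ∫ F(g₁, …, gₖ) dg₁ ⋯ dgₖ`. -/
structure IsAshtekarLewandowski [IsTopologicalGroup G] [CompactSpace G] [MeasurableSpace G]
    [BorelSpace G] (μ : Measure (GenConnection n M G)) : Prop where
  isProbabilityMeasure : IsProbabilityMeasure μ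
  regular : μ.Regular
  map_eq : ∀ (k : ℕ) (e : Fin k → PAPath n M), IsGraph e →
    μ.map (fun A i => A.hol (e i)) =
      Measure.pi fun _ : Fin k => Measure.haarMeasure (⊤ : TopologicalSpace.PositiveCompacts G)

/-- The map `v_Ā : [0, 1] → G`, `s ↦ Ā(e_s)`. -/
def transport (e : PAPath n M) (A : GenConnection n M G) (s : I) : G := A.hol (e.upTo s)

end Measure

end AL

/-!
If `v = v_Ā` is continuous at `s`, then `v t * (v t')⁻¹` tends to `1` as `t, t' → s`. Hence, for any
fixed neighbourhood `V` of `1`, there is a nondegenerate interval with rational end points on which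
all these quotients lie in `V`. There are countably many such intervals, so it suffices that for each
of them this event is null once `V` has Haar measure `r < 1`; such a `V` exists because `G` is
Hausdorff and nontrivial and Haar measure charges every nonempty open set.

By the composition law, `v b * (v a)⁻¹` is the parallel transport along the part of `e` between the
parameters `a` and `b` (`GenConnection.hol_segment`). Every nondegenerate interval contains one on
which `e` is a single embedded arc (`IsPiecewiseArcOn.exists_arc_subinterval`), and dividing that one
into `k` pieces produces a graph (`PAPath.isGraph_subdivision`). The `k` parallel transports are
therefore independent and Haar distributed, and they all lie in `V` with probability `r ^ k`, which
tends to `0` with growing `k` (`ae_exists_transport_mul_inv_notMem`).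
-/

namespace AL

variable {n : ℕ} {M : Type*} [TopologicalSpace M] [ChartedSpace (EuclideanSpace ℝ (Fin n)) M]

theorem IsAnalyticArcOn.mono {c : ℝ → M} {a b a' b' : ℝ} (h : IsAnalyticArcOn n c a b)
    (hab : a' < b') (ha : a ≤ a') (hb : b' ≤ b) : IsAnalyticArcOn n c a' b' :=
  h.comp_affine (k := 1) (m := 0) hab one_ne_zero
    (fun t ht => by rw [one_mul, add_zero]; exact ⟨ha.trans ht.1, ht.2.trans hb⟩)
    (fun t _ => by rw [one_mul, add_zero])

theorem IsPiecewiseArcOn.exists_arc_subinterval {c : ℝ → M} {a b : ℝ}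
    (h : IsPiecewiseArcOn n c a b) : ∀ {x y : ℝ}, x < y → a ≤ x → y ≤ b →
    ∃ x' y', IsAnalyticArcOn n c x' y' ∧ x ≤ x' ∧ y' ≤ y := by
  induction h with
  | arc h => exact fun {x y} hxy hx hy => ⟨x, y, h.mono hxy hx hy, le_rfl, le_rfl⟩
  | @concat a b d _ _ ih1 ih2 =>
    intro x y hxy hx hy
    rcases lt_or_ge x b with hb | hb
    · obtain ⟨x', y', h, h1, h2⟩ := ih1 (lt_min hxy hb) hx (min_le_right y b)
      exact ⟨x', y', h, h1, h2.trans (min_le_left _ _)⟩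
    · exact ih2 hxy hb hy

namespace PAPath

/-- The part of `p` between the parameters `a` and `b`, affinely reparametrized by `[0, 1]`. It is
meant for `a ≤ b` and `0 < b`: then it is the final segment, from parameter `a / b` on, of the initial
segment `p_b`. -/
noncomputable def segment (p : PAPath n M) (a b : I) : PAPath n M :=
  (p.upTo b).startingAt (projIcc 0 1 zero_le_one ((a : ℝ) / b))

theorem coe_projIcc_div {a b : I} (hab : a ≤ b) :
    (projIcc (0 : ℝ) 1 zero_le_one ((a : ℝ) / b) : ℝ) = a / b := by
  rw [projIcc_of_mem _ (show (a : ℝ) / b ∈ Icc (0 : ℝ) 1 from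
    ⟨div_nonneg a.2.1 b.2.1, div_le_one_of_le₀ hab b.2.1⟩)]

theorem segment_apply (p : PAPath n M) {a b : I} (hab : a < b) (t : I) :
    (p.segment a b).toMap t = IccExtend zero_le_one p.toMap (a + (b - a) * t) := by
  have hb : (0 : ℝ) < b := a.2.1.trans_lt hab
  have hm : (a : ℝ) + (b - a) * t ∈ Icc (0 : ℝ) 1 := by
    have h1 : (a : ℝ) < b := hab
    have := b.2.2
    exact ⟨add_nonneg a.2.1 (mul_nonneg (sub_pos.2 h1).le t.2.1),
      by nlinarith [t.2.2]⟩
  rw [IccExtend_of_mem _ _ hm]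
  refine congrArg p.toMap (Subtype.ext ?_)
  simp only [unitInterval.coe_symm_eq, Icc.coe_mul, coe_projIcc_div hab.le]
  field_simp
  ring

theorem isArc_segment (p : PAPath n M) {a b : I} {x y : ℝ} (hab : a < b)
    (h : IsAnalyticArcOn n (IccExtend zero_le_one p.toMap) x y) (hx : x ≤ a) (hy : b ≤ y) :
    (p.segment a b).IsArc := by
  have h1 : (a : ℝ) < b := hab
  refine h.comp_affine (k := b - a) (m := a) zero_lt_one (sub_pos.2 h1).ne' (fun t ht => ?_)
    (fun t ht => ?_)
  · constructor <;> nlinarith [ht.1, ht.2]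
  · rw [IccExtend_of_mem _ _ ht, p.segment_apply hab, add_comm]

/-- Consecutive pieces of a single arc meet only in the division points, since the arc is
injective. -/
theorem isGraph_subdivision (p : PAPath n M) {x y : ℝ}
    (h : IsAnalyticArcOn n (IccExtend zero_le_one p.toMap) x y) {k : ℕ} (t : Fin (k + 1) → I)
    (ht : StrictMono t) (hx : ∀ i, x ≤ t i) (hy : ∀ i, t i ≤ y) :
    IsGraph fun i : Fin k => p.segment (t i.castSucc) (t i.succ) := by
  have hlt (i : Fin k) : t i.castSucc < t i.succ := ht i.castSucc_lt_succ
  have hmem (i : Fin k) (s : I) :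
      (t i.castSucc + (t i.succ - t i.castSucc) * s : ℝ) ∈ Icc (t i.castSucc : ℝ) (t i.succ) := by
    have h1 : (t i.castSucc : ℝ) < t i.succ := hlt i
    constructor <;> nlinarith [s.2.1, s.2.2]
  have key (i j : Fin k) (hij : i < j) (s u : I)
      (hsu : (p.segment (t i.castSucc) (t i.succ)).toMap s =
        (p.segment (t j.castSucc) (t j.succ)).toMap u) : s = 1 ∧ u = 0 := by
    rw [p.segment_apply (hlt i), p.segment_apply (hlt j)] at hsu
    have heq := h.injOn ⟨(hx _).trans (hmem i s).1, (hmem i s).2.trans (hy _)⟩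
      ⟨(hx _).trans (hmem j u).1, (hmem j u).2.trans (hy _)⟩ hsu
    have hle : (t i.succ : ℝ) ≤ t j.castSucc := ht.monotone (Fin.succ_le_castSucc_iff.2 hij)
    have h1 : (0 : ℝ) < t i.succ - t i.castSucc := sub_pos.2 (hlt i)
    have h2 : (0 : ℝ) < t j.succ - t j.castSucc := sub_pos.2 (hlt j)
    have h3 := mul_nonneg h1.le (sub_nonneg.2 s.2.2)
    have h4 := mul_nonneg h2.le u.2.1
    -- both nonnegative quantities vanish, because their sum is nonpositive
    have h5 : (t i.succ - t i.castSucc : ℝ) * (1 - s) = 0 := by nlinarith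
    have h6 : (t j.succ - t j.castSucc : ℝ) * u = 0 := by nlinarith
    exact ⟨Subtype.ext (sub_eq_zero.1 ((mul_eq_zero.1 h5).resolve_left h1.ne')).symm,
      Subtype.ext ((mul_eq_zero.1 h6).resolve_left h2.ne')⟩
  refine ⟨fun i => p.isArc_segment (hlt i) h (hx _) (hy _), fun i j hij s u hsu => ?_⟩
  rcases lt_or_gt_of_ne hij with hlt | hlt
  · obtain ⟨hs, hu⟩ := key i j hlt s u hsu
    exact ⟨.inr hs, .inl hu⟩
  · obtain ⟨hu, hs⟩ := key j i hlt u s hsu.symm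
    exact ⟨.inl hs, .inr hu⟩

end PAPath

theorem GenConnection.hol_segment {G : Type*} [Group G] [TopologicalSpace G]
    (A : GenConnection n M G) (p : PAPath n M) {a b : I} (hab : a < b) :
    A.hol (p.segment a b) = transport p A b * (transport p A a)⁻¹ := by
  have hb : (0 : ℝ) < b := a.2.1.trans_lt hab
  have h1 : A.hol ((p.upTo b).upTo (projIcc 0 1 zero_le_one ((a : ℝ) / b))) = A.hol (p.upTo a) := by
    refine A.hol_reparam _ _ (OrderIso.refl I) fun t => congrArg p.toMap (Subtype.ext ?_)
    simp only [Icc.coe_mul, PAPath.coe_projIcc_div hab.le, OrderIso.refl_apply]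
    field_simp
  rw [eq_mul_inv_iff_mul_eq, transport, transport, ← h1]
  exact (A.hol_comp _ _).symm

theorem GenConnection.measurable_hol {G : Type*} [Group G] [TopologicalSpace G] [MeasurableSpace G]
    [BorelSpace G] (p : PAPath n M) : Measurable fun A : GenConnection n M G => A.hol p := by
  have h : Continuous (GenConnection.hol : GenConnection n M G → PAPath n M → G) :=
    continuous_induced_dom
  exact ((continuous_apply p).comp h).measurable

/-- Almost surely, the quotients `v_Ā(t) v_Ā(t')⁻¹` of parameters in a given nondegenerate interval
do not all stay in a set whose Haar measure is less than `1`. -/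
theorem ae_exists_transport_mul_inv_notMem {G : Type*} [Group G] [TopologicalSpace G]
    [IsTopologicalGroup G] [CompactSpace G] [MeasurableSpace G] [BorelSpace G]
    {μ : Measure (GenConnection n M G)} (hμ : IsAshtekarLewandowski μ)
    {e : PAPath n M} (he : e.IsPiecewiseArc) {V : Set G} (hV : MeasurableSet V)
    (hV1 : Measure.haarMeasure (⊤ : TopologicalSpace.PositiveCompacts G) V < 1)
    {x y : ℝ} (hxy : x < y) (hx : 0 ≤ x) (hy : y ≤ 1) :
    ∀ᵐ A ∂μ, ∃ t t' : I, (t : ℝ) ∈ Icc x y ∧ (t' : ℝ) ∈ Icc x y ∧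
      transport e A t * (transport e A t')⁻¹ ∉ V := by
  obtain ⟨x', y', harc, hxx, hyy⟩ := IsPiecewiseArcOn.exists_arc_subinterval he hxy hx hy
  have hlt := harc.lt
  rw [ae_iff]
  refine le_antisymm (ge_of_tendsto' (ENNReal.tendsto_pow_atTop_nhds_zero_of_lt_one hV1)
    fun k => ?_) zero_le
  have hτmem (i : Fin (k + 1)) : x' + (y' - x') * (i / (k + 1)) ∈ Icc x' y' := by
    have h1 : (i : ℝ) / (k + 1) ≤ 1 := by
      rw [div_le_one (by positivity)]; exact_mod_cast i.2.le
    have h0 : (0 : ℝ) ≤ (i : ℝ) / (k + 1) := by positivity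
    constructor <;> nlinarith
  let τ : Fin (k + 1) → I := fun i => ⟨x' + (y' - x') * (i / (k + 1)),
    (hx.trans hxx).trans (hτmem i).1, (hτmem i).2.trans (hyy.trans hy)⟩
  have hτ : StrictMono τ := by
    intro i j hij
    have h1 : (i : ℝ) / (k + 1) < j / (k + 1) := by
      gcongr
      exact_mod_cast hij
    exact Subtype.mk_lt_mk.2 (by nlinarith)
  have hgraph := e.isGraph_subdivision harc τ hτ (fun i => (hτmem i).1) (fun i => (hτmem i).2)
  calc _ ≤ μ ((fun (A : GenConnection n M G) (i : Fin k) =>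
          A.hol (e.segment (τ i.castSucc) (τ i.succ))) ⁻¹' univ.pi fun _ => V) := by
        refine measure_mono fun A hA i _ => ?_
        by_contra hAV
        beta_reduce at hAV
        rw [A.hol_segment e (hτ i.castSucc_lt_succ)] at hAV
        exact hA ⟨_, _, Icc_subset_Icc hxx hyy (hτmem _), Icc_subset_Icc hxx hyy (hτmem _), hAV⟩
    _ = Measure.haarMeasure (⊤ : TopologicalSpace.PositiveCompacts G) V ^ k := by
        rw [← Measure.map_apply
          (measurable_pi_lambda _ fun i => GenConnection.measurable_hol _)
          (MeasurableSet.univ_pi fun _ => hV), hμ.map_eq k _ hgraph, Measure.pi_pi]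
        simp

/-- In a nontrivial compact Hausdorff group the identity has an open neighbourhood that does not
carry the full Haar measure: its complement contains a nonempty open set. -/
theorem exists_isOpen_one_mem_haarMeasure_lt_one (G : Type*) [Group G] [TopologicalSpace G]
    [IsTopologicalGroup G] [T2Space G] [CompactSpace G] [Nontrivial G] [MeasurableSpace G]
    [BorelSpace G] : ∃ V : Set G, IsOpen V ∧ (1 : G) ∈ V ∧
      Measure.haarMeasure (⊤ : TopologicalSpace.PositiveCompacts G) V < 1 := by
  obtain ⟨g, hg⟩ := exists_ne (1 : G)
  obtain ⟨V, U, hVo, hUo, h1V, hgU, hVU⟩ := t2_separation hg.symm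
  have huniv : Measure.haarMeasure (⊤ : TopologicalSpace.PositiveCompacts G) univ = 1 :=
    Measure.haarMeasure_self
  refine ⟨V, hVo, h1V, ?_⟩
  rw [← huniv]
  refine (measure_mono hVU.subset_compl_right).trans_lt ?_
  rw [measure_compl hUo.measurableSet (measure_ne_top _ _)]
  exact ENNReal.sub_lt_self (measure_ne_top _ _) (by rw [huniv]; exact one_ne_zero)
    (hUo.measure_pos _ ⟨g, hgU⟩).ne'

theorem exists_rat_Icc_subset_ball (s : I) {ε : ℝ} (hε : 0 < ε) :
    ∃ p q : ℚ, (p : ℝ) < q ∧ (0 : ℝ) ≤ p ∧ (q : ℝ) ≤ 1 ∧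
      Icc (p : ℝ) q ⊆ Metric.ball (s : ℝ) ε := by
  have h : max 0 ((s : ℝ) - ε) < min 1 ((s : ℝ) + ε) := by
    rw [max_lt_iff, lt_min_iff, lt_min_iff]
    exact ⟨⟨zero_lt_one, by linarith [s.2.1]⟩, by linarith [s.2.2], by linarith⟩
  obtain ⟨p, hp, hp'⟩ := exists_rat_btwn h
  obtain ⟨q, hpq, hq⟩ := exists_rat_btwn hp'
  obtain ⟨hp0, hps⟩ := max_lt_iff.1 hp
  obtain ⟨hq1, hqs⟩ := lt_min_iff.1 hq
  refine ⟨p, q, hpq, hp0.le, hq1.le, ?_⟩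
  rw [Real.ball_eq_Ioo]
  exact Icc_subset_Ioo hps hqs

/-- The Cauchy criterion for continuity at a point, with the interval chosen from a countable
family. -/
theorem exists_rat_Icc_mul_inv_mem_of_continuousAt {G : Type*} [Group G] [TopologicalSpace G]
    [IsTopologicalGroup G] {v : I → G} {s : I} (hv : ContinuousAt v s) {V : Set G} (hVo : IsOpen V)
    (h1V : (1 : G) ∈ V) : ∃ p q : ℚ, (p : ℝ) < q ∧ (0 : ℝ) ≤ p ∧ (q : ℝ) ≤ 1 ∧
      ∀ t t' : I, (t : ℝ) ∈ Icc (p : ℝ) q → (t' : ℝ) ∈ Icc (p : ℝ) q → v t * (v t')⁻¹ ∈ V := by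
  have hlim : ContinuousAt (fun z : I × I => v z.1 * (v z.2)⁻¹) (s, s) :=
    (hv.comp (x := (s, s)) continuousAt_fst).mul (hv.comp (x := (s, s)) continuousAt_snd).inv
  have hnhds := hlim.preimage_mem_nhds (hVo.mem_nhds (by simpa using h1V))
  obtain ⟨ε, hε, hball⟩ := Metric.mem_nhds_iff.1 hnhds
  obtain ⟨p, q, hpq, hp, hq, hsub⟩ := exists_rat_Icc_subset_ball s hε
  refine ⟨p, q, hpq, hp, hq, fun t t' ht ht' => hball (a := (t, t')) ?_⟩
  rw [← ball_prod_same]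
  exact ⟨hsub ht, hsub ht'⟩

end AL

theorem theorem2 {n d : ℕ}
    {M : Type*} [TopologicalSpace M] [T2Space M] [SecondCountableTopology M] [ConnectedSpace M]
    [ChartedSpace (EuclideanSpace ℝ (Fin n)) M] [IsManifold (𝓡 n) ω M]
    {G : Type*} [Group G] [TopologicalSpace G] [IsTopologicalGroup G] [T2Space G]
    [CompactSpace G] [ConnectedSpace G] [Nontrivial G]
    [ChartedSpace (EuclideanSpace ℝ (Fin d)) G] [LieGroup (𝓡 d) ∞ G]
    [MeasurableSpace G] [BorelSpace G]
    (μ : Measure (AL.GenConnection n M G)) (hμ : AL.IsAshtekarLewandowski μ)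
    (e : AL.PAPath n M) (he : e.IsPiecewiseArc) :
    ∀ᵐ A ∂μ, ∀ s : I, ¬ ContinuousAt (AL.transport e A) s := by
  obtain ⟨V, hVo, h1V, hV⟩ := AL.exists_isOpen_one_mem_haarMeasure_lt_one G
  have hae : ∀ᵐ A ∂μ, ∀ p q : ℚ, (p : ℝ) < q → (0 : ℝ) ≤ p → (q : ℝ) ≤ 1 →
      ∃ t t' : I, (t : ℝ) ∈ Icc (p : ℝ) q ∧ (t' : ℝ) ∈ Icc (p : ℝ) q ∧
        AL.transport e A t * (AL.transport e A t')⁻¹ ∉ V := by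
    simp only [ae_all_iff]
    exact fun p q hpq hp hq =>
      AL.ae_exists_transport_mul_inv_notMem hμ he hVo.measurableSet hV hpq hp hq
  filter_upwards [hae] with A hA s hs
  obtain ⟨p, q, hpq, hp, hq, h⟩ := AL.exists_rat_Icc_mul_inv_mem_of_continuousAt hs hVo h1V
  obtain ⟨t, t', ht, ht', hV'⟩ := hA p q hpq hp hq
  exact hV' (h t t' ht ht')
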